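/- Let $q$ be a prime power, let $m$ be an odd prime, and let $n=(q-1)(q^m+1)$. A linear code of length $n$ over $\mathbb{F}_q$ is a linear subspace $\mathcal{C}\subseteq\mathbb{F}_q^n$. It is cyclic if $(c_{n-1},c_0,\dots,c_{n-2})\in\mathcal{C}$ whenever $(c_0,c_1,\dots,c_{n-1})\in\mathcal{C}$, and it is LCD (linear complementary dual) if $\mathcal{C}\cap\mathcal{C}^{\perp}=\{\mathbf{0}\}$, where $\mathcal{C}^{\perp}=\{\mathbf{x}\in\mathbb{F}_q^n : \sum_{i} x_ic_i=0 \text{ for all } \mathbf{c}\in\mathcal{C}\}$. 1. If $q$ is odd, then the total number of nonzero LCD cyclic codes of length $n$ over $\mathbb{F}_q$ is $$2^{\frac{(q+1)^2}{4}+\frac{q^2(q^{m-1}-1)}{4m}}-1.$$ 2. If $q$ is even, then the total number of nonzero LCD cyclic codes of length $n$ over $\mathbb{F}_q$ is $$2^{\frac{q^2(q^{m-1}+m-1)+2mq}{4m}}-1.$$ -/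

import Mathlib

/-- A linear code of length `n` over `F` (a subspace of `F ^ n`) is cyclic if it contains, with
every word `(c₀, c₁, …, cₙ₋₁)`, the shifted word `(cₙ₋₁, c₀, …, cₙ₋₂)`. -/
def IsCyclicCode {F : Type*} [Field F] {n : ℕ} (C : Submodule F (Fin n → F)) : Prop :=
  ∀ c ∈ C, (fun i => c ((finRotate n).symm i)) ∈ C

/-- The dual code, with respect to the standard inner product `∑ i, x i * c i`. -/
def dualCode {F : Type*} [Field F] {n : ℕ} (C : Submodule F (Fin n → F)) :
    Submodule F (Fin n → F) where
  carrier := {x | ∀ c ∈ C, x ⬝ᵥ c = 0}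
  add_mem' := by
    intro a b ha hb c hc
    rw [add_dotProduct, ha c hc, hb c hc, add_zero]
  zero_mem' := by
    intro c _
    exact zero_dotProduct c
  smul_mem' := by
    intro r x hx c hc
    rw [smul_dotProduct, hx c hc, smul_zero]

/-- A linear code is LCD (linear complementary dual) if it meets its dual code only in zero. -/
def IsLCDCode {F : Type*} [Field F] {n : ℕ} (C : Submodule F (Fin n → F)) : Prop :=
  C ⊓ dualCode C = ⊥

/-- The number of nonzero LCD cyclic codes of length `n` over `F`. -/
noncomputable def numLCDCyclicCodes (F : Type*) [Field F] (n : ℕ) : ℕ :=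
  Nat.card {C : Submodule F (Fin n → F) // C ≠ ⊥ ∧ IsCyclicCode C ∧ IsLCDCode C}

/-! An LCD cyclic code `C` splits the whole space orthogonally, and the orthogonal projection onto
`C` commutes with shifts, so it is a symmetric idempotent circulant matrix. Hence `C` corresponds to
an even idempotent `a` for cyclic convolution (`card_lcd_cyclic_codes`). Since `n` is invertible in
`F`, a Fourier transform over the algebraic closure turns `a` into the indicator of a subset of
`ℤ/n`; having values in `F` means stability under multiplication by `q`, and evenness means
stability under negation (`card_selfAdjointIdempotent`).

Such subsets are unions of orbits of `ℤ/2m × {±1}` on `ℤ/n`, where `n ∣ q^(2m) - 1`. Burnside's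
lemma (`ZMod.exists_card_stable_sets`) gives the number `N` of orbits as an average of the gcds of
`n` with `q^i ± 1`. As `m` is an odd prime, these depend only on the parity of `i`, except at `i =
0` and `i = m` (`sum_gcd_pow`). The parity of `q` enters only through `gcd(n, q^i + 1)` for even
`i`, which is 2 or 1. -/

/-! ### Greatest common divisors of `(q - 1)(q^m + 1)` with `q^i ± 1`. -/

theorem Int.gcd_eq_one_of_forall_prime {a b : ℤ}
    (h : ∀ p : ℕ, p.Prime → (a : ZMod p) = 0 → (b : ZMod p) = 0 → False) : Int.gcd a b = 1 := by
  by_contra hne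
  obtain ⟨p, hp, hd⟩ := Nat.exists_prime_and_dvd hne
  have hd' : (p : ℤ) ∣ (Int.gcd a b : ℤ) := by exact_mod_cast hd
  exact h p hp ((ZMod.intCast_zmod_eq_zero_iff_dvd _ _).2 (hd'.trans (Int.gcd_dvd_left ..)))
    ((ZMod.intCast_zmod_eq_zero_iff_dvd _ _).2 (hd'.trans (Int.gcd_dvd_right ..)))

section CommRing

variable {R : Type*} [CommRing R]

theorem Odd.add_one_mul_geom_sum_neg {m : ℕ} (hm : Odd m) (x : R) :
    (x + 1) * ∑ t ∈ Finset.range m, (-x) ^ t = x ^ m + 1 := by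
  have h := geom_sum_mul (-x) m
  rw [hm.neg_pow] at h
  linear_combination -h

theorem sq_eq_one_of_pow_add_one_of_pow_eq_one {x : R} {m j : ℕ} (hmj : m.Coprime j)
    (hm : x ^ m + 1 = 0) (hj : x ^ (2 * j) = 1) : x ^ 2 = 1 := by
  have hm' : (x ^ 2) ^ m = 1 := by
    rw [← pow_mul, mul_comm, pow_mul, eq_neg_of_add_eq_zero_left hm]; norm_num
  rw [pow_mul] at hj
  have := pow_gcd_eq_one.2 ⟨hm', hj⟩
  rwa [hmj.gcd_eq_one, pow_one] at this

theorem two_eq_zero_of_odd_even {x : R} {m i : ℕ} (hm : Odd m) (hi : Even i)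
    (hxm : x ^ m = -1) (hxi : x ^ i = -1) : (2 : R) = 0 := by
  have h1 : x ^ (m * i) = 1 := by rw [pow_mul, hxm, hi.neg_one_pow]
  have h2 : x ^ (m * i) = -1 := by rw [mul_comm, pow_mul, hxi, hm.neg_one_pow]
  rw [h1] at h2
  linear_combination h2

theorem two_eq_zero_of_odd {x : R} {m i : ℕ} (hi : Odd i)
    (hxm : x ^ m = -1) (hxi : x ^ i = 1) : (2 : R) = 0 := by
  have h1 : x ^ (m * i) = -1 := by rw [pow_mul, hxm, hi.neg_one_pow]
  have h2 : x ^ (m * i) = 1 := by rw [mul_comm, pow_mul, hxi, one_pow]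
  rw [h1] at h2
  linear_combination -h2

end CommRing

theorem ZMod.eq_two_of_two_eq_zero {p : ℕ} (hp : p.Prime) (h : (2 : ZMod p) = 0) : p = 2 := by
  have : ((2 : ℕ) : ZMod p) = 0 := by exact_mod_cast h
  rw [ZMod.natCast_eq_zero_iff] at this
  exact (Nat.prime_dvd_prime_iff_eq hp Nat.prime_two).1 this

theorem ZMod.two_eq_zero_or_eq_one : ∀ x : ZMod 2, x = 0 ∨ x = 1 := by decide

theorem ZMod.not_both_cast_eq_zero {p a b : ℕ} (hp : p.Prime) (hab : a.Coprime b)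
    (ha : (a : ZMod p) = 0) (hb : (b : ZMod p) = 0) : False := by
  rw [ZMod.natCast_eq_zero_iff] at ha hb
  exact hp.one_lt.ne' (Nat.eq_one_of_dvd_coprimes hab ha hb)

/-- After dividing by `q - 1`, a common prime `p` has `q^m = -1` and `q^i = 1` with `i` odd, so `p =
2`; but then the geometric sum is `i` modulo 2, which is nonzero. -/
theorem gcd_pow_sub_one_of_odd {q : ℤ} (hq : 1 ≤ q) {m i : ℕ} (hi : Odd i) :
    (Int.gcd ((q - 1) * (q ^ m + 1)) (q ^ i - 1) : ℤ) = q - 1 := by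
  rw [← mul_geom_sum q i, Int.gcd_mul_left, Int.gcd_eq_one_of_forall_prime, mul_one,
    Int.natAbs_of_nonneg (by linarith)]
  intro p hp h1 h2
  have := Fact.mk hp
  push_cast at h1 h2
  have hi1 : (q : ZMod p) ^ i = 1 := by
    have := mul_geom_sum (q : ZMod p) i
    rw [h2, mul_zero] at this
    linear_combination -this
  have hp2 := ZMod.eq_two_of_two_eq_zero hp
    (two_eq_zero_of_odd hi (eq_neg_of_add_eq_zero_left h1) hi1)
  subst hp2
  have hq1 : (q : ZMod 2) = 1 := by
    refine (ZMod.two_eq_zero_or_eq_one q).resolve_left fun h => ?_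
    rw [h, zero_pow hi.pos.ne'] at hi1
    exact zero_ne_one hi1
  rw [hq1] at h2
  simp only [one_pow, Finset.sum_const, Finset.card_range, nsmul_eq_mul, mul_one] at h2
  rw [ZMod.natCast_eq_zero_iff] at h2
  exact (Nat.not_even_iff_odd.2 hi) (even_iff_two_dvd.2 h2)

/-- After dividing by `q ^ 2 - 1`, a common prime forces `q = ±1` modulo it. For `q = 1` the
alternating sum is 1; for `q = -1` the two cofactors become the coprime numbers `m` and `j`. -/
theorem gcd_pow_sub_one_of_even {q : ℤ} (hq : 1 ≤ q) {m j : ℕ} (hm : Odd m)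
    (hmj : m.Coprime j) :
    (Int.gcd ((q - 1) * (q ^ m + 1)) (q ^ (2 * j) - 1) : ℤ) = q ^ 2 - 1 := by
  have e1 : (q - 1) * (q ^ m + 1) = (q ^ 2 - 1) * ∑ t ∈ Finset.range m, (-q) ^ t := by
    rw [← hm.add_one_mul_geom_sum_neg]; ring
  rw [e1, pow_mul, ← mul_geom_sum (q ^ 2) j, Int.gcd_mul_left, Int.gcd_eq_one_of_forall_prime,
    mul_one, Int.natAbs_of_nonneg (by nlinarith)]
  intro p hp h1 h2
  have := Fact.mk hp
  push_cast at h1 h2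
  have hm1 : (q : ZMod p) ^ m + 1 = 0 := by
    rw [← hm.add_one_mul_geom_sum_neg, h1, mul_zero]
  have hj1 : (q : ZMod p) ^ (2 * j) = 1 := by
    have := mul_geom_sum ((q : ZMod p) ^ 2) j
    rw [h2, mul_zero, ← pow_mul] at this
    linear_combination -this
  have hsq := sq_eq_one_of_pow_add_one_of_pow_eq_one hmj hm1 hj1
  rw [hsq] at h2
  simp only [one_pow, Finset.sum_const, Finset.card_range, nsmul_eq_mul, mul_one] at h2
  rcases mul_self_eq_one_iff.1 ((sq _).symm.trans hsq) with h | h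
  · rw [h, neg_one_geom_sum, if_neg (Nat.not_even_iff_odd.2 hm)] at h1
    exact one_ne_zero h1
  · rw [h] at h1
    simp only [neg_neg, one_pow, Finset.sum_const, Finset.card_range, nsmul_eq_mul, mul_one] at h1
    exact ZMod.not_both_cast_eq_zero hp hmj h1 h2

theorem gcd_pow_add_one_of_odd {q : ℤ} (hq : 1 ≤ q) {m i : ℕ} (hm : Odd m) (hi : Odd i)
    (hmi : m.Coprime i) :
    (Int.gcd ((q - 1) * (q ^ m + 1)) (q ^ i + 1) : ℤ) = q + 1 := by
  have e1 : (q - 1) * (q ^ m + 1) = (q + 1) * ((q - 1) * ∑ t ∈ Finset.range m, (-q) ^ t) := by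
    rw [← hm.add_one_mul_geom_sum_neg]; ring
  rw [e1, ← hi.add_one_mul_geom_sum_neg, Int.gcd_mul_left, Int.gcd_eq_one_of_forall_prime,
    mul_one, Int.natAbs_of_nonneg (by linarith)]
  intro p hp h1 h2
  have := Fact.mk hp
  push_cast at h1 h2
  have hne : (q : ZMod p) ≠ 1 := by
    intro h
    rw [h, neg_one_geom_sum, if_neg (Nat.not_even_iff_odd.2 hi)] at h2
    exact one_ne_zero h2
  replace h1 := (mul_eq_zero.1 h1).resolve_left (sub_ne_zero.2 hne)
  have hm1 : (q : ZMod p) ^ m + 1 = 0 := by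
    rw [← hm.add_one_mul_geom_sum_neg, h1, mul_zero]
  have hi1 : (q : ZMod p) ^ (2 * i) = 1 := by
    have : (q : ZMod p) ^ i + 1 = 0 := by rw [← hi.add_one_mul_geom_sum_neg, h2, mul_zero]
    rw [mul_comm, pow_mul, eq_neg_of_add_eq_zero_left this]; norm_num
  have hsq := sq_eq_one_of_pow_add_one_of_pow_eq_one hmi hm1 hi1
  have h := (mul_self_eq_one_iff.1 ((sq _).symm.trans hsq)).resolve_left hne
  rw [h] at h1 h2
  simp only [neg_neg, one_pow, Finset.sum_const, Finset.card_range, nsmul_eq_mul, mul_one] at h1 h2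
  exact ZMod.not_both_cast_eq_zero hp hmi h1 h2

theorem two_eq_zero_of_length_eq_zero {K : Type*} [Field K] {x : K} {m i : ℕ} (hm : Odd m)
    (hi : Even i) (h1 : (x - 1) * (x ^ m + 1) = 0) (h2 : x ^ i + 1 = 0) : (2 : K) = 0 := by
  rcases mul_eq_zero.1 h1 with h | h
  · rw [sub_eq_zero.1 h, one_pow] at h2
    linear_combination h2
  · exact two_eq_zero_of_odd_even hm hi (eq_neg_of_add_eq_zero_left h)
      (eq_neg_of_add_eq_zero_left h2)

theorem gcd_pow_add_one_of_even_of_even {q : ℤ} (hq : Even q) {m i : ℕ} (hm : Odd m)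
    (hi : Even i) : Int.gcd ((q - 1) * (q ^ m + 1)) (q ^ i + 1) = 1 := by
  refine Int.gcd_eq_one_of_forall_prime fun p hp h1 h2 => ?_
  have := Fact.mk hp
  push_cast at h1 h2
  have hp2 := ZMod.eq_two_of_two_eq_zero hp (two_eq_zero_of_length_eq_zero hm hi h1 h2)
  subst hp2
  rw [(ZMod.intCast_zmod_eq_zero_iff_dvd q 2).2 (by exact_mod_cast hq.two_dvd),
    zero_pow hm.pos.ne'] at h1
  norm_num at h1

/-- An odd square plus one is twice an odd number, so only one factor 2 is shared; any other common
prime would also have to be 2. -/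
theorem gcd_pow_add_one_of_odd_of_even {q : ℤ} (hq : Odd q) {m i : ℕ} (hm : Odd m)
    (hi : Even i) : Int.gcd ((q - 1) * (q ^ m + 1)) (q ^ i + 1) = 2 := by
  obtain ⟨j, rfl⟩ := hi
  obtain ⟨c, hc⟩ := hq.pow (n := j)
  obtain ⟨d, hd⟩ := hq
  have e1 : (q - 1) * (q ^ m + 1) = 2 * (d * (q ^ m + 1)) := by rw [hd]; ring
  have e2 : q ^ (j + j) + 1 = 2 * (2 * (c ^ 2 + c) + 1) := by rw [pow_add, hc]; ring
  have key : Int.gcd (d * (q ^ m + 1)) (2 * (c ^ 2 + c) + 1) = 1 := by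
    refine Int.gcd_eq_one_of_forall_prime fun p hp h1 h2 => ?_
    have := Fact.mk hp
    have h1' : (((q - 1) * (q ^ m + 1) : ℤ) : ZMod p) = 0 := by
      rw [e1, Int.cast_mul, h1, mul_zero]
    have h2' : ((q ^ (j + j) + 1 : ℤ) : ZMod p) = 0 := by rw [e2, Int.cast_mul, h2, mul_zero]
    push_cast at h1' h2' h2
    have h := two_eq_zero_of_length_eq_zero hm ⟨j, rfl⟩ h1' h2'
    rw [h, zero_mul, zero_add] at h2
    exact one_ne_zero h2
  rw [e1, e2, Int.gcd_mul_left, key]; rfl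

/-! ### Orbit counting on `ℤ/n`. -/

theorem ZMod.card_intCast_mul_eq_zero (n : ℕ) [NeZero n] (c : ℤ) :
    Nat.card {x : ZMod n // (c : ZMod n) * x = 0} = Int.gcd n c := by
  have h := IsAddCyclic.card_nsmulAddMonoidHom_ker (ZMod n) c.natAbs
  rw [Nat.card_zmod] at h
  rw [Int.gcd_eq_natAbs_gcd_natAbs, Int.natAbs_natCast, ← h]
  refine Nat.card_congr (Equiv.subtypeEquivRight fun x => ?_)
  rw [AddMonoidHom.mem_ker, nsmulAddMonoidHom_apply, nsmul_eq_mul]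
  rcases Int.natAbs_eq c with hc | hc <;> rw [hc] <;> simp

/-- The subsets stable under a group action correspond to the sets of orbits. -/
def MulAction.stableSetEquivSetOrbits (G X : Type*) [Group G] [MulAction G X] :
    {S : Set X // ∀ g : G, ∀ x ∈ S, g • x ∈ S} ≃ Set (orbitRel.Quotient G X) where
  toFun S := Quotient.mk _ '' S.1
  invFun T := ⟨Quotient.mk _ ⁻¹' T, fun g x hx => by
    have : (Quotient.mk (orbitRel G X) (g • x)) = Quotient.mk _ x := Quotient.sound ⟨g, rfl⟩
    rw [Set.mem_preimage, this]; exact hx⟩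
  left_inv S := by
    refine Subtype.ext (Set.Subset.antisymm ?_ (Set.subset_preimage_image _ _))
    rintro x ⟨y, hy, hxy⟩
    obtain ⟨g, rfl⟩ := Quotient.exact hxy
    simpa using S.2 g⁻¹ _ hy
  right_inv T := Set.image_preimage_eq _ Quotient.mk_surjective

/-- The homomorphism from `ℤ/k` sending `1` to an element with trivial `k`-th power. -/
def zmodPowHom {H : Type*} [Group H] (k : ℕ) [NeZero k] (u : H) (hu : u ^ k = 1) :
    Multiplicative (ZMod k) →* H :=
  MonoidHom.mk' (fun i => u ^ (Multiplicative.toAdd i).val) fun i j => by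
    rw [toAdd_mul, ZMod.val_add, ← pow_eq_pow_mod _ hu, pow_add]

theorem ZMod.sum_val (k : ℕ) [NeZero k] (f : ℕ → ℕ) :
    ∑ i : ZMod k, f i.val = ∑ i ∈ Finset.range k, f i := by
  cases k with
  | zero => exact absurd rfl (NeZero.ne 0)
  | succ k => exact Fin.sum_univ_eq_sum_range f (k + 1)

/-- Burnside's lemma for `ℤ/k × {±1}`, with `(i, e)` acting as `e * q ^ i`: its fixed points are the
kernel of `q ^ i - 1` or `q ^ i + 1`. The action need not be faithful, so `k` need not be the exact
order of `q`. -/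
theorem ZMod.exists_card_stable_sets (n k : ℕ) [NeZero n] [NeZero k] (q : ℕ)
    (hq : (q : ZMod n) ^ k = 1) :
    ∃ N : ℕ, Nat.card {S : Set (ZMod n) // ∀ x ∈ S, (q : ZMod n) * x ∈ S ∧ -x ∈ S} = 2 ^ N ∧
      N * (2 * k) =
        ∑ i ∈ Finset.range k, (Int.gcd n (q ^ i - 1) + Int.gcd n (q ^ i + 1)) := by
  classical
  let u : (ZMod n)ˣ := Units.ofPowEqOne (q : ZMod n) k hq (NeZero.ne k)
  have hu : u ^ k = 1 := Units.pow_ofPowEqOne hq (NeZero.ne k)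
  let φ : Multiplicative (ZMod k) × ℤˣ →* (ZMod n)ˣ :=
    (zmodPowHom k u hu).coprod (Units.map (Int.castRingHom (ZMod n)).toMonoidHom)
  let _ : MulAction (Multiplicative (ZMod k) × ℤˣ) (ZMod n) := MulAction.compHom _ φ
  have hsmul (i : ZMod k) (e : ℤˣ) (x : ZMod n) :
      ((Multiplicative.ofAdd i, e) : Multiplicative (ZMod k) × ℤˣ) • x =
        q ^ i.val * ((e : ℤ) : ZMod n) * x := rfl
  have hpow (i : ℕ) : ((i : ZMod k).val : ℕ) = i % k := ZMod.val_natCast k i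
  let Q := MulAction.orbitRel.Quotient (Multiplicative (ZMod k) × ℤˣ) (ZMod n)
  refine ⟨Fintype.card Q, ?_, ?_⟩
  · rw [← Fintype.card_set, ← Nat.card_eq_fintype_card]
    refine Nat.card_congr (Equiv.trans (Equiv.subtypeEquivRight fun S => ?_)
      (MulAction.stableSetEquivSetOrbits (Multiplicative (ZMod k) × ℤˣ) (ZMod n)))
    constructor
    · rintro h ⟨i, e⟩ x hx
      change (q : ZMod n) ^ (ZMod.val (n := k) i) * ((e : ℤ) : ZMod n) * x ∈ S
      have key : ∀ j : ℕ, ∀ y ∈ S, (q : ZMod n) ^ j * y ∈ S := by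
        intro j
        induction j with
        | zero => intro y hy; simpa using hy
        | succ j ih =>
          intro y hy
          rw [pow_succ', mul_assoc]
          exact (h _ (ih y hy)).1
      rw [mul_assoc]
      apply key
      rcases Int.units_eq_one_or e with rfl | rfl
      · simpa using hx
      · simpa using (h x hx).2
    · intro h x hx
      constructor
      · have := h (Multiplicative.ofAdd ((1 : ℕ) : ZMod k), 1) x hx
        rw [hsmul, hpow, ← pow_eq_pow_mod _ hq] at this
        simpa using this
      · have := h (Multiplicative.ofAdd ((0 : ℕ) : ZMod k), -1) x hx
        rw [hsmul, hpow, ← pow_eq_pow_mod _ hq] at this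
        simpa using this
  · have hB := MulAction.sum_card_fixedBy_eq_card_orbits_mul_card_group
      (Multiplicative (ZMod k) × ℤˣ) (ZMod n)
    have hcard : Nat.card (Multiplicative (ZMod k) × ℤˣ) = 2 * k := by
      rw [Nat.card_prod, Nat.card_congr Multiplicative.toAdd, Nat.card_zmod,
        Nat.card_eq_fintype_card (α := ℤˣ), Fintype.card_units_int, mul_comm]
    rw [← Nat.card_eq_fintype_card (α := _ × ℤˣ), hcard] at hB
    rw [← hB, Fintype.sum_prod_type, ← ZMod.sum_val k]
    symm
    refine Fintype.sum_equiv Multiplicative.ofAdd _ _ fun i => ?_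
    have huniv : (Finset.univ : Finset ℤˣ) = {1, -1} := rfl
    rw [huniv, Finset.sum_pair (by decide)]
    symm
    congr 1
    · rw [← ZMod.card_intCast_mul_eq_zero, ← Nat.card_eq_fintype_card]
      refine Nat.card_congr (Equiv.subtypeEquivRight fun x => ?_)
      rw [MulAction.mem_fixedBy, hsmul, ← sub_eq_zero (b := x)]
      push_cast
      ring_nf
    · rw [← ZMod.card_intCast_mul_eq_zero, ← Nat.card_eq_fintype_card]
      refine Nat.card_congr (Equiv.subtypeEquivRight fun x => ?_)
      rw [MulAction.mem_fixedBy, hsmul, ← neg_eq_zero, ← sub_eq_zero (b := x)]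
      push_cast
      ring_nf

/-! ### LCD cyclic codes as even idempotents. -/

open scoped Matrix

section SelfOrthogonalComplement

variable {F : Type*} [Field F] {n : ℕ}

theorem mem_dualCode {C : Submodule F (Fin n → F)} {x : Fin n → F} :
    x ∈ dualCode C ↔ ∀ c ∈ C, x ⬝ᵥ c = 0 := Iff.rfl

theorem IsLCDCode.sup_dualCode {C : Submodule F (Fin n → F)} (hC : IsLCDCode C) :
    C ⊔ dualCode C = ⊤ := by
  let B : LinearMap.BilinForm F (Fin n → F) := dotProductBilin F F
  have hB : B.IsRefl := fun x y h => (dotProduct_comm y x).trans h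
  have hdual : B.orthogonal C = dualCode C := by
    ext x
    exact forall₂_congr fun c _ => by
      rw [← dotProduct_comm]; rfl
  have hdisj : Disjoint C (B.orthogonal C) := by
    rw [disjoint_iff, hdual]; exact hC
  rw [← hdual]
  exact ((LinearMap.BilinForm.isCompl_orthogonal_iff_disjoint hB).2 hdisj).sup_eq_top

variable [NeZero n]

theorem IsCyclicCode.translate_mem {C : Submodule F (Fin n → F)} (hC : IsCyclicCode C)
    {c : Fin n → F} (hc : c ∈ C) (j : Fin n) : (fun i => c (i - j)) ∈ C := by
  obtain ⟨k, rfl⟩ := Nat.exists_eq_succ_of_ne_zero (NeZero.ne n)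
  have hshift : ∀ c ∈ C, (fun i => c (i - 1)) ∈ C := by
    intro c hc
    have hrot : ∀ i : Fin (k + 1), (finRotate (k + 1)).symm i = i - 1 := fun i => by
      rw [Equiv.symm_apply_eq, finRotate_apply, sub_add_cancel]
    simpa only [hrot] using hC c hc
  induction j using Fin.induction with
  | zero => simpa using hc
  | succ j ih =>
    have := hshift _ ih
    rw [← Fin.coeSucc_eq_succ]
    convert this using 3
    abel

theorem isCyclicCode_of_translate_mem {C : Submodule F (Fin n → F)}
    (hC : ∀ c ∈ C, ∀ j, (fun i => c (i - j)) ∈ C) : IsCyclicCode C := by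
  obtain ⟨k, rfl⟩ := Nat.exists_eq_succ_of_ne_zero (NeZero.ne n)
  intro c hc
  have hrot : ∀ i : Fin (k + 1), (finRotate (k + 1)).symm i = i - 1 := fun i => by
    rw [Equiv.symm_apply_eq, finRotate_apply, sub_add_cancel]
  simpa only [hrot] using hC c hc 1

theorem IsCyclicCode.dualCode {C : Submodule F (Fin n → F)} (hC : IsCyclicCode C) :
    IsCyclicCode (dualCode C) := by
  refine isCyclicCode_of_translate_mem fun x hx j => mem_dualCode.2 fun c hc => ?_
  rw [← mem_dualCode.1 hx _ (hC.translate_mem hc (-j))]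
  exact Fintype.sum_equiv (Equiv.subRight j) _ _ fun i => by simp

theorem IsCyclicCode.circulant_mulVec_mem {C : Submodule F (Fin n → F)} (hC : IsCyclicCode C)
    {a : Fin n → F} (ha : a ∈ C) (v : Fin n → F) : Matrix.circulant a *ᵥ v ∈ C := by
  have : Matrix.circulant a *ᵥ v = ∑ j, v j • fun i => a (i - j) := by
    ext i
    simp [Matrix.mulVec, dotProduct, mul_comm]
  rw [this]
  exact C.sum_mem fun j _ => C.smul_mem _ (hC.translate_mem ha j)

/-- Vectors whose circulant matrix is an orthogonal projection. -/
def IsSelfAdjointIdempotent {ι : Type*} [Fintype ι] [AddGroup ι] (a : ι → F) : Prop :=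
  Matrix.circulant a *ᵥ a = a ∧ ∀ i, a (-i) = a i

theorem IsSelfAdjointIdempotent.circulant_mul_self {a : Fin n → F}
    (ha : IsSelfAdjointIdempotent a) :
    Matrix.circulant a * Matrix.circulant a = Matrix.circulant a := by
  rw [Matrix.circulant_mul, ha.1]

theorem IsSelfAdjointIdempotent.transpose_circulant {a : Fin n → F}
    (ha : IsSelfAdjointIdempotent a) : (Matrix.circulant a)ᵀ = Matrix.circulant a :=
  Matrix.circulant_isSymm_iff.2 ha.2

/-- The code of all multiples of a vector under cyclic convolution. -/
def convolutionCode (a : Fin n → F) : Submodule F (Fin n → F) :=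
  LinearMap.range (Matrix.circulant a).mulVecLin

theorem IsSelfAdjointIdempotent.mem_convolutionCode_iff {a x : Fin n → F}
    (ha : IsSelfAdjointIdempotent a) :
    x ∈ convolutionCode a ↔ Matrix.circulant a *ᵥ x = x := by
  refine ⟨?_, fun h => ⟨x, h⟩⟩
  rintro ⟨v, rfl⟩
  rw [Matrix.mulVecLin_apply, Matrix.mulVec_mulVec, ha.circulant_mul_self]

theorem isCyclicCode_convolutionCode (a : Fin n → F) : IsCyclicCode (convolutionCode a) := by
  refine isCyclicCode_of_translate_mem ?_
  rintro _ ⟨v, rfl⟩ j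
  refine ⟨fun i => v (i - j), funext fun i => ?_⟩
  exact Fintype.sum_equiv (Equiv.subRight j) _ _ fun k => by
    simp [sub_sub_sub_cancel_right]

theorem IsSelfAdjointIdempotent.isLCDCode {a : Fin n → F} (ha : IsSelfAdjointIdempotent a) :
    IsLCDCode (convolutionCode a) := by
  refine (Submodule.eq_bot_iff _).2 fun x hx => ?_
  obtain ⟨h1, h2⟩ := Submodule.mem_inf.1 hx
  refine dotProduct_eq_zero_iff.1 fun w => ?_
  rw [← ha.mem_convolutionCode_iff.1 h1, ← ha.transpose_circulant, Matrix.mulVec_transpose,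
    ← Matrix.dotProduct_mulVec]
  exact mem_dualCode.1 h2 _ ⟨w, rfl⟩

/-- Each generator acts as the identity on the common code, and convolution is commutative, so `b =
a * b = b * a = a`. -/
theorem convolutionCode_injOn {a b : Fin n → F} (ha : IsSelfAdjointIdempotent a)
    (hb : IsSelfAdjointIdempotent b) (h : convolutionCode a = convolutionCode b) : a = b := by
  have h1 : Matrix.circulant a *ᵥ b = b := by
    rw [← ha.mem_convolutionCode_iff, h, hb.mem_convolutionCode_iff, hb.1]
  have h2 : Matrix.circulant b *ᵥ a = a := by
    rw [← hb.mem_convolutionCode_iff, ← h, ha.mem_convolutionCode_iff, ha.1]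
  refine Matrix.circulant_injective ?_
  rw [← h1, ← Matrix.circulant_mul, Matrix.circulant_mul_comm, Matrix.circulant_mul, h2]

/-- The idempotent is the component in `C` of the unit vector at 0, the identity for convolution. -/
theorem exists_convolutionCode_eq {C : Submodule F (Fin n → F)} (hC : IsCyclicCode C)
    (hL : IsLCDCode C) : ∃ a, IsSelfAdjointIdempotent a ∧ convolutionCode a = C := by
  obtain ⟨a, ha, b, hb, hab⟩ := Submodule.mem_sup.1
    (hL.sup_dualCode ▸ Submodule.mem_top : (Pi.single 0 1 : Fin n → F) ∈ C ⊔ dualCode C)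
  have hsum : Matrix.circulant a + Matrix.circulant b = 1 := by
    rw [← Matrix.circulant_add, hab, Matrix.circulant_single_one]
  have hfix : ∀ v ∈ C, Matrix.circulant a *ᵥ v = v := by
    intro v hv
    have hdec : Matrix.circulant a *ᵥ v + Matrix.circulant b *ᵥ v = v := by
      rw [← Matrix.add_mulVec, hsum, Matrix.one_mulVec]
    have hbC : Matrix.circulant b *ᵥ v ∈ C := by
      rw [← eq_sub_iff_add_eq'] at hdec
      rw [hdec]
      exact C.sub_mem hv (hC.circulant_mulVec_mem ha v)
    have h0 : Matrix.circulant b *ᵥ v = 0 :=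
      (Submodule.eq_bot_iff _).1 hL _ ⟨hbC, hC.dualCode.circulant_mulVec_mem hb v⟩
    rwa [h0, add_zero] at hdec
  -- The entries are inner products of shifts of `b` with shifts of `a`. With `B = 1 - A` this gives
  -- `A = Aᵀ * A`, which is symmetric.
  have horth : (Matrix.circulant b)ᵀ * Matrix.circulant a = 0 := by
    ext i j
    exact mem_dualCode.1 (hC.dualCode.translate_mem hb i) _ (hC.translate_mem ha j)
  have hsymm : (Matrix.circulant a)ᵀ = Matrix.circulant a := by
    rw [← eq_sub_iff_add_eq'] at hsum
    rw [hsum, Matrix.transpose_sub, Matrix.transpose_one, sub_mul, one_mul, sub_eq_zero] at horth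
    have h := congrArg Matrix.transpose horth
    rw [Matrix.transpose_mul, Matrix.transpose_transpose, ← horth] at h
    exact h
  refine ⟨a, ⟨hfix a ha, Matrix.circulant_isSymm_iff.1 hsymm⟩, le_antisymm ?_ ?_⟩
  · rintro _ ⟨v, rfl⟩
    exact hC.circulant_mulVec_mem ha v
  · exact fun v hv => ⟨v, hfix v hv⟩

theorem card_lcd_cyclic_codes (F : Type*) [Field F] (n : ℕ) [NeZero n] :
    Nat.card {C : Submodule F (Fin n → F) // IsCyclicCode C ∧ IsLCDCode C} =
      Nat.card {a : Fin n → F // IsSelfAdjointIdempotent a} := by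
  symm
  refine Nat.card_congr (Equiv.ofBijective (fun a => ⟨convolutionCode a.1,
    isCyclicCode_convolutionCode a.1, a.2.isLCDCode⟩) ⟨?_, ?_⟩)
  · intro a b h
    exact Subtype.ext (convolutionCode_injOn a.2 b.2 (congrArg Subtype.val h))
  · rintro ⟨C, hC, hL⟩
    obtain ⟨a, ha, rfl⟩ := exists_convolutionCode_eq hC hL
    exact ⟨⟨a, ha⟩, rfl⟩

theorem numLCDCyclicCodes_add_one (F : Type*) [Field F] [Finite F] (n : ℕ) [NeZero n] :
    numLCDCyclicCodes F n + 1 = Nat.card {a : Fin n → F // IsSelfAdjointIdempotent a} := by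
  rw [← card_lcd_cyclic_codes]
  have hbot : IsCyclicCode (⊥ : Submodule F (Fin n → F)) ∧
      IsLCDCode (⊥ : Submodule F (Fin n → F)) :=
    ⟨fun c hc => by rw [(Submodule.mem_bot F).1 hc]; exact Submodule.zero_mem _, bot_inf_eq _⟩
  have := Finite.of_injective (fun C : Submodule F (Fin n → F) => (C : Set (Fin n → F)))
    SetLike.coe_injective
  have h := Set.ncard_sdiff_singleton_add_one
    (s := {C : Submodule F (Fin n → F) | IsCyclicCode C ∧ IsLCDCode C}) hbot
  rw [← Nat.card_coe_set_eq, ← Nat.card_coe_set_eq] at h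
  refine Eq.trans (congrArg (· + 1) (Nat.card_congr (Equiv.subtypeEquivRight fun C => ?_))) h
  exact and_comm

end SelfOrthogonalComplement

/-! ### Frobenius descent and the Fourier transform on `ℤ/n`. -/

/-- `X ^ q - X` already splits over `F`, so it gains no roots in `K`. -/
theorem FiniteField.exists_algebraMap_eq_of_pow_card_eq {F K : Type*} [Field F] [Fintype F]
    [Field K] [Algebra F K] {x : K} (hx : x ^ Fintype.card F = x) :
    ∃ a : F, algebraMap F K a = x := by
  open Polynomial in
  have hs : (X ^ Fintype.card F - X : F[X]).Splits := by
    rw [splits_iff_card_roots, FiniteField.roots_X_pow_card_sub_X,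
      FiniteField.X_pow_card_sub_X_natDegree_eq _ Fintype.one_lt_card]
    rfl
  have hr := hs.roots_map (algebraMap F K)
  rw [FiniteField.roots_X_pow_card_sub_X] at hr
  have hmem : x ∈ ((Polynomial.X ^ Fintype.card F - Polynomial.X : Polynomial F).map
      (algebraMap F K)).roots := by
    rw [Polynomial.mem_roots (by
      simpa using FiniteField.X_pow_card_sub_X_ne_zero K (Fintype.one_lt_card (α := F)))]
    simp [hx]
  rw [hr, Multiset.mem_map] at hmem
  obtain ⟨a, _, ha⟩ := hmem
  exact ⟨a, ha⟩

theorem FiniteField.sum_pow_card {F K ι : Type*} [Field F] [Fintype F] [Field K] [Algebra F K]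
    (s : Finset ι) (f : ι → K) :
    (∑ i ∈ s, f i) ^ Fintype.card F = ∑ i ∈ s, f i ^ Fintype.card F :=
  map_sum (FiniteField.frobeniusAlgHom F K) f s

section CharSum

variable {K : Type*} [Field K] {n : ℕ} [NeZero n]

/-- The discrete Fourier transform on `ℤ/n` with respect to a character `ψ`. -/
def charSum (ψ : AddChar (ZMod n) K) (b : ZMod n → K) (k : ZMod n) : K :=
  ∑ j, b j * ψ (j * k)

theorem charSum_circulant_mulVec (ψ : AddChar (ZMod n) K) (b c : ZMod n → K) (k : ZMod n) :
    charSum ψ (Matrix.circulant b *ᵥ c) k = charSum ψ b k * charSum ψ c k := by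
  have h1 : charSum ψ (Matrix.circulant b *ᵥ c) k =
      ∑ j, ∑ i, b (i - j) * c j * ψ (i * k) := by
    rw [Finset.sum_comm]
    simp only [charSum, Matrix.mulVec, dotProduct, Matrix.circulant_apply, Finset.sum_mul]
  rw [h1, charSum, charSum, Finset.sum_mul_sum]
  refine Eq.trans ?_ Finset.sum_comm
  refine Finset.sum_congr rfl fun j _ => ?_
  refine Fintype.sum_equiv (Equiv.subRight j) _ _ fun i => ?_
  have : ψ (i * k) = ψ ((i - j) * k) * ψ (j * k) := by
    rw [← AddChar.map_add_eq_mul]; ring_nf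
  rw [this, Equiv.subRight_apply]
  ring

theorem charSum_comp_neg (ψ : AddChar (ZMod n) K) (b : ZMod n → K) (k : ZMod n) :
    charSum ψ (fun j => b (-j)) k = charSum ψ b (-k) :=
  Fintype.sum_equiv (Equiv.neg _) _ _ fun j => by simp

variable {ψ : AddChar (ZMod n) K}

theorem sum_charSum_mul (hψ : ψ.IsPrimitive) (b : ZMod n → K) (i : ZMod n) :
    ∑ k, charSum ψ b k * ψ (-(k * i)) = n * b i := by
  have h : ∀ j, ∑ k, b j * ψ (j * k) * ψ (-(k * i)) = if j = i then n * b i else 0 := by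
    intro j
    have h1 := AddChar.sum_mulShift (j - i) hψ
    rw [ZMod.card] at h1
    have h2 : ∑ k, b j * ψ (j * k) * ψ (-(k * i)) = b j * ∑ k, ψ (k * (j - i)) := by
      rw [Finset.mul_sum]
      refine Finset.sum_congr rfl fun k _ => ?_
      rw [mul_assoc, ← AddChar.map_add_eq_mul]
      ring_nf
    rw [h2, h1]
    by_cases hji : j = i
    · subst hji; simp [mul_comm]
    · simp [hji, sub_eq_zero]
  simp only [charSum, Finset.sum_mul]
  rw [Finset.sum_comm]
  simp only [h]
  simp

theorem charSum_injective (hψ : ψ.IsPrimitive) (hn : (n : K) ≠ 0) :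
    Function.Injective (charSum ψ) := by
  intro b c h
  ext i
  refine mul_left_cancel₀ hn ?_
  rw [← sum_charSum_mul hψ, ← sum_charSum_mul hψ, h]

theorem charSum_inverse (hψ : ψ.IsPrimitive) (hn : (n : K) ≠ 0) (g : ZMod n → K) :
    charSum ψ (fun j => (n : K)⁻¹ * ∑ k, g k * ψ (-(k * j))) = g := by
  have h1 : ∀ j, ∑ k, g k * ψ (-(k * j)) = charSum ψ g (-j) := fun j => by
    simp [charSum]
  ext i
  have h2 : charSum ψ (fun j => (n : K)⁻¹ * ∑ k, g k * ψ (-(k * j))) i =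
      (n : K)⁻¹ * ∑ k, charSum ψ g k * ψ (-(k * i)) := by
    simp only [h1]
    rw [charSum, Finset.mul_sum]
    exact Fintype.sum_equiv (Equiv.neg _) _ _ fun j => by simp [mul_assoc]
  rw [h2, sum_charSum_mul hψ, inv_mul_cancel_left₀ hn]

end CharSum

/-! ### Even idempotents as stable subsets of `ℤ/n`. -/

section Spectrum

variable {F K : Type*} [Field F] [Field K] [Algebra F K] {n : ℕ} [NeZero n]

theorem isSelfAdjointIdempotent_iff_charSum {ψ : AddChar (ZMod n) K} (hψ : ψ.IsPrimitive)
    (hn : (n : K) ≠ 0) (a : ZMod n → F) :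
    IsSelfAdjointIdempotent a ↔
      (∀ k, charSum ψ (fun j => algebraMap F K (a j)) k = 0 ∨
        charSum ψ (fun j => algebraMap F K (a j)) k = 1) ∧
      ∀ k, charSum ψ (fun j => algebraMap F K (a j)) (-k) =
        charSum ψ (fun j => algebraMap F K (a j)) k := by
  set b : ZMod n → K := fun j => algebraMap F K (a j) with hb
  have hinj := (algebraMap F K).injective
  refine and_congr ?_ ?_
  · have h1 : Matrix.circulant a *ᵥ a = a ↔ Matrix.circulant b *ᵥ b = b := by
      rw [funext_iff, funext_iff]
      refine forall_congr' fun i => ?_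
      rw [← hinj.eq_iff]
      simp [Matrix.mulVec, dotProduct, hb]
    rw [h1, ← (charSum_injective hψ hn).eq_iff, funext_iff]
    refine forall_congr' fun k => ?_
    rw [charSum_circulant_mulVec]
    exact IsIdempotentElem.iff_eq_zero_or_one
  · have h1 : (∀ i, a (-i) = a i) ↔ (fun j => b (-j)) = b := by
      rw [funext_iff]
      exact forall_congr' fun i => hinj.eq_iff.symm
    rw [h1, ← (charSum_injective hψ hn).eq_iff, funext_iff]
    simp only [charSum_comp_neg]

variable [Fintype F]

theorem charSum_card_mul (ψ : AddChar (ZMod n) K) (a : ZMod n → F) (k : ZMod n) :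
    charSum ψ (fun j => algebraMap F K (a j)) ((Fintype.card F : ZMod n) * k) =
      charSum ψ (fun j => algebraMap F K (a j)) k ^ Fintype.card F := by
  rw [charSum, charSum, FiniteField.sum_pow_card]
  refine Finset.sum_congr rfl fun j _ => ?_
  rw [mul_pow, ← map_pow, FiniteField.pow_card, ← AddChar.map_nsmul_eq_pow, nsmul_eq_mul]
  ring_nf

open Classical in
-- Frobenius permutes the terms of the inverse transform of the indicator along `k ↦ q * k`, so its
-- values are fixed and descend to `F`.
theorem exists_charSum_eq_indicator {ψ : AddChar (ZMod n) K} (hψ : ψ.IsPrimitive)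
    (hn : (n : K) ≠ 0) {S : Set (ZMod n)} (hS : ∀ x ∈ S, (Fintype.card F : ZMod n) * x ∈ S)
    (hq : IsUnit (Fintype.card F : ZMod n)) :
    ∃ a : ZMod n → F, ∀ k, charSum ψ (fun j => algebraMap F K (a j)) k =
      if k ∈ S then 1 else 0 := by
  let g : ZMod n → K := fun k => if k ∈ S then 1 else 0
  let e : Equiv.Perm (ZMod n) := Equiv.ofBijective (fun x => (Fintype.card F : ZMod n) * x)
    (Finite.injective_iff_bijective.1 hq.isRegular.left)
  -- An injective self-map of the finite set `S` is onto `S`, so forward stability suffices.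
  have he : ∀ x, e x ∈ S ↔ x ∈ S := by
    intro x
    refine ⟨fun hx => ?_, hS x⟩
    have hmaps : Set.MapsTo e S S := hS
    have hbij := ((Set.toFinite S).injOn_iff_bijOn_of_mapsTo hmaps).1 e.injective.injOn
    obtain ⟨y, hy, hyx⟩ := hbij.surjOn hx
    exact e.injective hyx ▸ hy
  have hfix : ∀ j, ∃ a : F, algebraMap F K a = (n : K)⁻¹ * ∑ k, g k * ψ (-(k * j)) := by
    intro j
    apply FiniteField.exists_algebraMap_eq_of_pow_card_eq
    have hninv : (n : K)⁻¹ ^ Fintype.card F = (n : K)⁻¹ := by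
      have : (n : K)⁻¹ = algebraMap F K (n : F)⁻¹ := by simp
      rw [this, ← map_pow, FiniteField.pow_card]
    rw [mul_pow, FiniteField.sum_pow_card, hninv]
    congr 1
    refine Fintype.sum_equiv e _ _ fun k => ?_
    have hg : g (e k) = g k := by simp only [g, he]
    have hg' : g k ^ Fintype.card F = g k := by
      simp only [g]; split_ifs <;> simp
    rw [mul_pow, hg, hg', ← AddChar.map_nsmul_eq_pow, nsmul_eq_mul]
    change _ = g k * ψ (-((Fintype.card F : ZMod n) * k * j))
    ring_nf
  choose a ha using hfix
  refine ⟨a, fun k => ?_⟩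
  simp only [ha]
  rw [charSum_inverse hψ hn]

theorem card_selfAdjointIdempotent (F : Type*) [Field F] [Fintype F] (n : ℕ) [NeZero n]
    (hn : (n : F) ≠ 0) (hq : IsUnit (Fintype.card F : ZMod n)) :
    Nat.card {a : ZMod n → F // IsSelfAdjointIdempotent a} =
      Nat.card {S : Set (ZMod n) // ∀ x ∈ S, (Fintype.card F : ZMod n) * x ∈ S ∧ -x ∈ S} := by
  classical
  have : NeZero (n : F) := ⟨hn⟩
  let K := AlgebraicClosure F
  have hnK : (n : K) ≠ 0 := by
    rw [← map_natCast (algebraMap F K)]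
    exact (map_ne_zero _).2 hn
  obtain ⟨ζ, hζ⟩ := HasEnoughRootsOfUnity.exists_primitiveRoot K n
  obtain ⟨ψ, hψ⟩ : ∃ ψ : AddChar (ZMod n) K, ψ.IsPrimitive :=
    ⟨_, AddChar.zmodChar_primitive_of_primitive_root n hζ⟩
  let D : (ZMod n → F) → ZMod n → K := fun a => charSum ψ fun j => algebraMap F K (a j)
  have hD : Function.Injective D := fun a b h => by
    ext i
    exact (algebraMap F K).injective (congrFun (charSum_injective hψ hnK h) i)
  refine Nat.card_congr (Equiv.ofBijective (fun a => ⟨{k | D a.1 k = 1}, fun k hk => ?_⟩) ⟨?_, ?_⟩)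
  · have h := (isSelfAdjointIdempotent_iff_charSum hψ hnK a.1).1 a.2
    refine ⟨?_, (h.2 k).trans hk⟩
    change D a.1 k = 1 at hk
    change D a.1 _ = 1
    simp only [D] at hk ⊢
    rw [charSum_card_mul, hk, one_pow]
  · intro a b h
    refine Subtype.ext (hD (funext fun k => ?_))
    have ha := ((isSelfAdjointIdempotent_iff_charSum hψ hnK a.1).1 a.2).1 k
    have hb := ((isSelfAdjointIdempotent_iff_charSum hψ hnK b.1).1 b.2).1 k
    have hk : D a.1 k = 1 ↔ D b.1 k = 1 := Set.ext_iff.1 (congrArg Subtype.val h) k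
    change D a.1 k = 0 ∨ D a.1 k = 1 at ha
    change D b.1 k = 0 ∨ D b.1 k = 1 at hb
    rcases ha with ha | ha <;> rcases hb with hb | hb <;> simp_all
  · rintro ⟨S, hS⟩
    obtain ⟨a, ha⟩ := exists_charSum_eq_indicator (F := F) hψ hnK (fun x hx => (hS x hx).1) hq
    have hneg : ∀ k, -k ∈ S ↔ k ∈ S := fun k =>
      ⟨fun h => by simpa using (hS _ h).2, fun h => (hS _ h).2⟩
    refine ⟨⟨a, (isSelfAdjointIdempotent_iff_charSum hψ hnK a).2 ⟨fun k => ?_, fun k => ?_⟩⟩, ?_⟩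
    · rw [ha]; split_ifs <;> simp
    · simp only [ha, hneg]
    · refine Subtype.ext (Set.ext fun k => ?_)
      change charSum ψ (fun j => algebraMap F K (a j)) k = 1 ↔ k ∈ S
      rw [ha]; split_ifs with h <;> simp [h]

end Spectrum

/-! ### Evaluation of the exponent. -/

theorem Finset.sum_range_two_mul_ite_even (m : ℕ) (a b : ℤ) :
    ∑ i ∈ Finset.range (2 * m), (if Even i then a else b) = m * (a + b) := by
  induction m with
  | zero => simp
  | succ m ih =>
    rw [Nat.mul_succ, Finset.sum_range_succ, Finset.sum_range_succ, ih,
      if_pos (even_two_mul m), if_neg (by simp [parity_simps])]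
    push_cast
    ring

theorem sum_gcd_pow {q : ℤ} (hq : 1 ≤ q) {m : ℕ} (hm : m.Prime) (hm2 : Odd m) (c : ℕ)
    (hc : ∀ i : ℕ, Even i → Int.gcd ((q - 1) * (q ^ m + 1)) (q ^ i + 1) = c) :
    ((∑ i ∈ Finset.range (2 * m), (Int.gcd ((q - 1) * (q ^ m + 1)) (q ^ i - 1) +
      Int.gcd ((q - 1) * (q ^ m + 1)) (q ^ i + 1)) : ℕ) : ℤ) =
      q ^ (m + 1) - q ^ 2 + m * (q ^ 2 + 2 * q + c - 1) := by
  have hterm : ∀ i ∈ Finset.range (2 * m),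
      ((Int.gcd ((q - 1) * (q ^ m + 1)) (q ^ i - 1) +
        Int.gcd ((q - 1) * (q ^ m + 1)) (q ^ i + 1) : ℕ) : ℤ) =
      -- The generic value by parity, corrected at `i = 0`, where `gcd(n, 0) = n` replaces `q ^ 2 -
      -- 1`, and at `i = m`, where `q ^ m + 1` replaces `q + 1`.
      (if Even i then q ^ 2 - 1 + c else 2 * q) +
        (if i = 0 then (q - 1) * (q ^ m + 1) - (q ^ 2 - 1) else 0) +
        (if i = m then q ^ m - q else 0) := by
    intro i hi
    rw [Finset.mem_range] at hi
    push_cast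
    rcases Nat.even_or_odd i with he | ho
    · have him : i ≠ m := by rintro rfl; exact (Nat.not_even_iff_odd.2 hm2) he
      rw [hc i he, if_pos he, if_neg him]
      obtain ⟨j, rfl⟩ := even_iff_exists_two_mul.1 he
      rcases Nat.eq_zero_or_pos j with rfl | hj
      · have : 0 ≤ (q - 1) * (q ^ m + 1) := by
          have := sub_nonneg.2 hq
          positivity
        simp only [mul_zero, pow_zero, sub_self, Int.gcd_zero, if_true,
          Int.natAbs_of_nonneg this]
        ring
      · rw [gcd_pow_sub_one_of_even hq hm2
          ((Nat.Prime.coprime_iff_not_dvd hm).2 fun h => (Nat.le_of_dvd hj h).not_gt (by lia)),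
          if_neg (by lia)]
        ring
    · have hi0 : i ≠ 0 := ho.pos.ne'
      rw [gcd_pow_sub_one_of_odd hq ho, if_neg (Nat.not_even_iff_odd.2 ho), if_neg hi0]
      by_cases him : i = m
      · subst him
        have : 0 ≤ q ^ i + 1 := by positivity
        rw [Int.gcd_mul_left_left, Int.natAbs_of_nonneg this, if_pos rfl]
        ring
      · have hcop : m.Coprime i := by
          refine (Nat.Prime.coprime_iff_not_dvd hm).2 ?_
          rintro ⟨t, rfl⟩
          have ht : t < 2 := by
            by_contra h
            have := Nat.mul_le_mul_left m (not_lt.1 h)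
            lia
          interval_cases t <;> simp at *
        rw [gcd_pow_add_one_of_odd hq hm2 ho hcop, if_neg him]
        ring
  have hpos := hm.pos
  rw [Nat.cast_sum, Finset.sum_congr rfl hterm, Finset.sum_add_distrib, Finset.sum_add_distrib,
    Finset.sum_range_two_mul_ite_even, Finset.sum_ite_eq' _ 0, Finset.sum_ite_eq' _ m,
    if_pos (by simpa using hpos), if_pos (by simp; lia)]
  ring

theorem exists_numLCDCyclicCodes_add_one_eq {F : Type*} [Field F] [Fintype F] {q m n : ℕ}
    (hq : Fintype.card F = q) (hn : n = (q - 1) * (q ^ m + 1)) (hm : 0 < m) :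
    ∃ N : ℕ, numLCDCyclicCodes F n + 1 = 2 ^ N ∧
      N * (2 * (2 * m)) =
        ∑ i ∈ Finset.range (2 * m), (Int.gcd n (q ^ i - 1) + Int.gcd n (q ^ i + 1)) := by
  have hq1 : 1 < q := hq ▸ Fintype.one_lt_card
  have hnpos : 0 < n := by
    rw [hn]; exact Nat.mul_pos (Nat.sub_pos_of_lt hq1) (Nat.succ_pos _)
  -- In successor form `ZMod (l + 1)` is `Fin (l + 1)` by definition, which joins the code side to
  -- the Fourier side.
  obtain ⟨l, rfl⟩ := Nat.exists_eq_succ_of_ne_zero hnpos.ne'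
  have : NeZero (2 * m) := ⟨by lia⟩
  -- Since `q = 0` in `F`, the length is `-1` there.
  have hnF : ((l + 1 : ℕ) : F) ≠ 0 := by
    have hqF : (q : F) = 0 := by rw [← hq]; exact FiniteField.cast_card_eq_zero F
    rw [← Nat.succ_eq_add_one, hn]
    push_cast [Nat.cast_sub hq1.le]
    rw [hqF, zero_pow hm.ne']
    simp
  have hqn : ((q : ZMod (l + 1))) ^ (2 * m) = 1 := by
    have h0 : (((q - 1) * (q ^ m + 1) : ℕ) : ZMod (l + 1)) = 0 := by
      rw [← hn]; exact ZMod.natCast_self _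
    push_cast [Nat.cast_sub hq1.le] at h0
    rw [mul_comm 2 m, pow_mul, ← sub_eq_zero]
    have h1 : ((q : ZMod (l + 1)) ^ m) ^ 2 - 1 =
        (∑ t ∈ Finset.range m, (q : ZMod (l + 1)) ^ t) *
          (((q : ZMod (l + 1)) - 1) * ((q : ZMod (l + 1)) ^ m + 1)) := by
      rw [← mul_assoc, geom_sum_mul]; ring
    rw [h1, h0, mul_zero]
  obtain ⟨N, hN, hsum⟩ := ZMod.exists_card_stable_sets (l + 1) (2 * m) q hqn
  refine ⟨N, ?_, hsum⟩
  rw [← hN]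
  refine (numLCDCyclicCodes_add_one F (l + 1)).trans ?_
  have := card_selfAdjointIdempotent F (l + 1) hnF
    (by rw [hq]; exact IsUnit.of_pow_eq_one hqn (NeZero.ne _))
  rw [hq] at this
  exact this

theorem numLCDCyclicCodes_eq_rpow {F : Type*} [Field F] [Fintype F] {q m n : ℕ}
    (hq : Fintype.card F = q) (hm : m.Prime) (hm_odd : Odd m)
    (hn : n = (q - 1) * (q ^ m + 1)) (c : ℕ)
    (hc : ∀ i : ℕ, Even i →
      Int.gcd (((q : ℤ) - 1) * ((q : ℤ) ^ m + 1)) ((q : ℤ) ^ i + 1) = c) :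
    (numLCDCyclicCodes F n : ℝ) =
      (2 : ℝ) ^ (((q : ℝ) ^ (m + 1) - (q : ℝ) ^ 2 + m * ((q : ℝ) ^ 2 + 2 * q + c - 1)) /
        (4 * m)) - 1 := by
  obtain ⟨N, hN, hsum⟩ := exists_numLCDCyclicCodes_add_one_eq hq hn hm.pos
  have hq1 : 1 < q := hq ▸ Fintype.one_lt_card
  have hnZ : (n : ℤ) = ((q : ℤ) - 1) * ((q : ℤ) ^ m + 1) := by
    rw [hn]; push_cast [Nat.cast_sub hq1.le]; ring
  have hs := sum_gcd_pow (q := q) (by exact_mod_cast hq1.le) hm hm_odd c hc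
  rw [← hnZ, ← hsum] at hs
  have hsR : (N : ℝ) * (2 * (2 * m)) =
      (q : ℝ) ^ (m + 1) - (q : ℝ) ^ 2 + m * ((q : ℝ) ^ 2 + 2 * q + c - 1) := by
    exact_mod_cast congrArg (Int.cast (R := ℝ)) hs
  have hm0 : (m : ℝ) ≠ 0 := Nat.cast_ne_zero.2 hm.ne_zero
  have hexp : ((q : ℝ) ^ (m + 1) - (q : ℝ) ^ 2 + m * ((q : ℝ) ^ 2 + 2 * q + c - 1)) / (4 * m) =
      N := by
    rw [← hsR]; field_simp; norm_num
  rw [hexp, Real.rpow_natCast, eq_sub_iff_add_eq]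
  exact_mod_cast hN

theorem mainTheorem11 {F : Type*} [Field F] [Fintype F] (q m n : ℕ)
    (hq : Fintype.card F = q) (hm : m.Prime) (hm_odd : Odd m)
    (hn : n = (q - 1) * (q ^ m + 1)) :
    (Odd q → (numLCDCyclicCodes F n : ℝ) =
      (2 : ℝ) ^ (((q : ℝ) + 1) ^ 2 / 4 +
        (q : ℝ) ^ 2 * ((q : ℝ) ^ (m - 1) - 1) / (4 * (m : ℝ))) - 1) ∧
    (Even q → (numLCDCyclicCodes F n : ℝ) =
      (2 : ℝ) ^ (((q : ℝ) ^ 2 * ((q : ℝ) ^ (m - 1) + (m : ℝ) - 1) + 2 * (m : ℝ) * (q : ℝ)) /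
        (4 * (m : ℝ))) - 1) := by
  have hm0 : (m : ℝ) ≠ 0 := Nat.cast_ne_zero.2 hm.ne_zero
  have hpow : (q : ℝ) ^ 2 * (q : ℝ) ^ (m - 1) = (q : ℝ) ^ (m + 1) := by
    rw [← pow_add]; congr 1; have := hm.pos; lia
  constructor
  · intro hodd
    rw [numLCDCyclicCodes_eq_rpow hq hm hm_odd hn 2 fun i hi =>
      gcd_pow_add_one_of_odd_of_even (by exact_mod_cast hodd) hm_odd hi]
    congr 2
    rw [← hpow]
    generalize (q : ℝ) ^ (m - 1) = t
    push_cast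
    field_simp
    ring
  · intro heven
    rw [numLCDCyclicCodes_eq_rpow hq hm hm_odd hn 1 fun i hi =>
      gcd_pow_add_one_of_even_of_even (by exact_mod_cast heven) hm_odd hi]
    congr 3
    rw [← hpow]
    push_cast
    ring
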